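/- Let $k$ be a field of characteristic $0$. A variety over $k$ is a reduced separated scheme of finite type over $k$, and a linear algebraic group over $k$ is a smooth affine group scheme of finite type over $k$. Let $G$ be a connected linear algebraic group over $k$ and let $G_1 \subseteq G$ be a closed subgroup which is also a connected linear algebraic group over $k$. Let $A$ and $B$ be geometrically integral varieties over $k$, each equipped with an action of $G$ over $k$, and let $\lambda : A \to B$ be a $G$-equivariant morphism over $k$. Assume that $B$ is affine and smooth over $k$ and that $B = G/G_1$ as a $G$-variety, i.e. there is a $G$-equivariant faithfully flat $k$-morphism $\pi : G \to B$ (with $G$ acting on itself by left translation) such that $(g,h) \mapsto (g, gh)$ is an isomorphism $G \times_k G_1 \to G \times_B G$. Then for every point $b \in B$ the scheme-theoretic fiber $\lambda^{-1}(b)$ is nonempty and geometrically integral over the residue field $\kappa(b)$. Moreover, if $A$ is smooth over $k$, then the morphism $\lambda$ is smooth. -/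

import Mathlib

open CategoryTheory Limits MonoidalCategory CartesianMonoidalCategory MonObj AlgebraicGeometry

universe u

namespace GVar

variable {k : Type u} [Field k]

/-- A variety over `k`: a reduced separated scheme of finite type over `k`. -/
structure IsVariety (X : Over (Spec (.of k))) : Prop where
  isReduced : IsReduced X.left
  isSeparated : IsSeparated X.hom
  locallyOfFiniteType : LocallyOfFiniteType X.hom
  quasiCompact : QuasiCompact X.hom

/-- A geometrically integral variety over `k`. -/
structure IsGeomIntegralVariety (X : Over (Spec (.of k))) : Prop extends IsVariety X where
  geometricallyIntegral : GeometricallyIntegral X.hom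

/-- A connected linear algebraic group over `k`: a group object in `k`-schemes whose underlying
scheme is a smooth, affine and connected variety. -/
structure IsConnectedLinearAlgebraicGroup (G : Over (Spec (.of k))) [GrpObj G] : Prop
    extends IsVariety G where
  isAffine : IsAffine G.left
  smooth : Smooth G.hom
  connected : ConnectedSpace G.left

/-- `i` exhibits `G₁` as a closed algebraic subgroup of `G`: it is a homomorphism of group schemes
over `k` and a closed immersion. -/
structure IsClosedSubgroup {G₁ G : Over (Spec (.of k))} [GrpObj G₁] [GrpObj G]
    (i : G₁ ⟶ G) : Prop where
  isMonHom : IsMonHom i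
  isClosedImmersion : IsClosedImmersion i.left

/-- `π : G ⟶ B` exhibits the `k`-scheme `B` with left `G`-action as the homogeneous space `G / G₁`,
for the subgroup `i : G₁ ⟶ G`: `π` is faithfully flat, equivariant for left translation on `G` and
the given action on `B`, and two points of `G` have the same image exactly when they differ by right
translation by a unique point of `G₁`, i.e. `G ×ₖ G₁ ≅ G ×_B G` via `(g, h) ↦ (g, g h)`. -/
structure IsHomogeneousQuotient {G₁ G B : Over (Spec (.of k))} [GrpObj G₁] [GrpObj G]
    [ModObj G B] (i : G₁ ⟶ G) (π : G ⟶ B) : Prop where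
  equivariant : μ[G] ≫ π = G ◁ π ≫ γ[G, B]
  flat : Flat π.left
  surjective : Surjective π.left
  isPullback : IsPullback (fst G G₁) (G ◁ i ≫ μ[G]) π π

end GVar

/-! Let `F` be the fiber of `f` over the base point of `B`. By equivariance, pulling `f` back along
`π` gives the projection G × F → G, with (g, x) ↦ g·x as the map to `A`
(`isPullback_smul_of_isPullback`). The base change of `π` along itself is G × G₁ → G, and a
connected smooth group is geometrically integral, so by descent `π`, and with it the action map G ×
F → A, is smooth and geometrically integral. Hence G × F is geometrically integral over `k`; this
descends to `F`, so it holds for G × F → G and descends along `π` to `f`. If `A` is smooth, so is G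
× F, hence its retract `F`, hence G × F → G, and fpqc descent along `π` gives smoothness of `f`. -/

namespace AlgebraicGeometry

variable {X Y S T : Scheme.{u}}

/-! ### Smooth morphisms are geometrically reduced. -/

section Reduced

/-- A scheme which is étale over a field is reduced. -/
lemma isReduced_of_etale_of_field {K : Type u} [Field K] (f : X ⟶ Spec (.of K)) [Etale f] :
    IsReduced X := by
  wlog hX : ∃ R, X = Spec R generalizing X
  · have (i : _) : IsReduced (X.affineCover.X i) := this (X.affineCover.f i ≫ f) ⟨_, rfl⟩
    exact .of_openCover _ X.affineCover
  obtain ⟨R, rfl⟩ := hX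
  obtain ⟨φ, rfl⟩ := Spec.map_surjective f
  have hφ := (HasRingHomProperty.Spec_iff (P := @Etale)).mp ‹_›
  algebraize [φ.hom]
  have := Algebra.FormallyUnramified.isReduced_of_field K R
  infer_instance

instance (priority := low) GeometricallyReduced.of_etale (f : X ⟶ Y) [Etale f] :
    GeometricallyReduced f where
  geometrically_isReduced K _ _ _ _ snd h :=
    have : Etale snd := MorphismProperty.of_isPullback h ‹_›
    isReduced_of_etale_of_field snd

/-- Standard smooth means étale over a polynomial ring, which is reduced; étale maps preserve this.
-/
lemma isReduced_of_isStandardSmooth {K S : Type u} [Field K] [CommRing S] {φ : K →+* S}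
    (hφ : φ.IsStandardSmooth) : _root_.IsReduced S := by
  obtain ⟨n, g, -, hg⟩ := hφ.exists_etale_mvPolynomial
  let f : Spec (.of S) ⟶ Spec (.of (MvPolynomial (Fin n) K)) := Spec.map (CommRingCat.ofHom g)
  have : Etale f := by
    rw [HasRingHomProperty.Spec_iff (P := @Etale)]
    exact hg
  have := GeometricallyReduced.isReduced_of_flat_of_isLocallyNoetherian f
  exact (affine_isReduced_iff _).mp this

/-- A ring which is smooth over a field is reduced. -/
lemma isReduced_of_ringHomSmooth {K S : Type u} [Field K] [CommRing S] {φ : K →+* S}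
    (hφ : φ.Smooth) : _root_.IsReduced S := by
  obtain ⟨s, hs, H⟩ := RingHom.smooth_iff_locally_isStandardSmooth.mp hφ
  refine ⟨fun x hx ↦ (Submodule.mem_bot S).mp <|
    Submodule.mem_of_span_eq_top_of_smul_pow_mem _ s hs _ fun t ↦ ?_⟩
  have := isReduced_of_isStandardSmooth (H t t.2)
  have hx' := (hx.map (algebraMap S (Localization.Away t.1))).eq_zero
  rw [IsLocalization.map_eq_zero_iff (Submonoid.powers t.1)] at hx'
  obtain ⟨⟨_, n, rfl⟩, hn⟩ := hx'
  exact ⟨n, hn⟩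

/-- A scheme which is smooth over a field is reduced. -/
lemma isReduced_of_smooth_of_field {K : Type u} [Field K] (f : X ⟶ Spec (.of K)) [Smooth f] :
    IsReduced X := by
  wlog hX : ∃ R, X = Spec R generalizing X
  · have (i : _) : IsReduced (X.affineCover.X i) := this (X.affineCover.f i ≫ f) ⟨_, rfl⟩
    exact .of_openCover _ X.affineCover
  obtain ⟨R, rfl⟩ := hX
  obtain ⟨φ, rfl⟩ := Spec.map_surjective f
  have := isReduced_of_ringHomSmooth ((HasRingHomProperty.Spec_iff (P := @Smooth)).mp ‹_›)
  infer_instance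

instance (priority := low) GeometricallyReduced.of_smooth (f : X ⟶ Y) [Smooth f] :
    GeometricallyReduced f where
  geometrically_isReduced K _ _ _ _ snd h :=
    have : Smooth snd := MorphismProperty.of_isPullback h ‹_›
    isReduced_of_smooth_of_field snd

end Reduced

/-! ### Descent and composition of geometric integrality. -/

section Descent

/-- Being reduced descends along flat surjective morphisms. -/
lemma IsReduced.of_flat_of_surjective (p : X ⟶ Y) [Flat p] [Surjective p] [IsReduced X] :
    IsReduced Y := by
  suffices ∀ y, _root_.IsReduced (Y.presheaf.stalk y) from isReduced_of_isReduced_stalk Y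
  intro y
  obtain ⟨x, rfl⟩ := p.surjective y
  have hf := Flat.stalkMap p x
  algebraize [(p.stalkMap x).hom]
  have : IsLocalHom (algebraMap (Y.presheaf.stalk (p x)) (X.presheaf.stalk x)) :=
    inferInstanceAs (IsLocalHom (p.stalkMap x).hom)
  have := Module.FaithfullyFlat.of_flat_of_isLocalHom
    (A := Y.presheaf.stalk (p x)) (B := X.presheaf.stalk x)
  exact isReduced_of_injective (algebraMap (Y.presheaf.stalk (p x)) (X.presheaf.stalk x))
    (FaithfulSMul.algebraMap_injective _ _)

/-- Being integral descends along flat surjective morphisms. -/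
lemma IsIntegral.of_flat_of_surjective (p : X ⟶ Y) [Flat p] [Surjective p] [IsIntegral X] :
    IsIntegral Y := by
  have := IsReduced.of_flat_of_surjective p
  have := p.surjective.irreducibleSpace p.continuous
  exact isIntegral_of_irreducibleSpace_of_isReduced Y

/-- If `X ⟶ Y` is flat and surjective and `X` is geometrically integral over `S`,
then so is `Y`. -/
lemma GeometricallyIntegral.of_comp_of_flat_of_surjective (p : X ⟶ Y) (f : Y ⟶ S) [Flat p]
    [Surjective p] [GeometricallyIntegral (p ≫ f)] : GeometricallyIntegral f where
  geometrically_isIntegral K _ s Z fst snd h := by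
    have : IsIntegral (pullback p fst) :=
      GeometricallyIntegral.geometrically_isIntegral (f := p ≫ f) s _ _
        ((IsPullback.of_hasPullback p fst).paste_vert h)
    exact IsIntegral.of_flat_of_surjective (pullback.snd p fst)

/-- Geometric integrality descends along surjective base change. -/
lemma GeometricallyIntegral.of_isPullback_of_surjective {f' : X ⟶ T} {q : X ⟶ Y} {f : Y ⟶ S}
    {g : T ⟶ S} (h : IsPullback q f' f g) [Surjective g] [GeometricallyIntegral f'] :
    GeometricallyIntegral f where
  geometrically_isIntegral K _ s Z fst snd hZ := by
    obtain ⟨t, ht⟩ := g.surjective (s (IsLocalRing.closedPoint K))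
    -- The residue field of `y` is an extension of `K` through which `s` lifts to `T`.
    obtain ⟨y, -⟩ := Scheme.Pullback.exists_preimage_pullback t _ ht
    let P := pullback g s
    let t : Spec (P.residueField y) ⟶ T := P.fromSpecResidueField y ≫ pullback.fst g s
    let r : Spec (P.residueField y) ⟶ Spec (.of K) :=
      P.fromSpecResidueField y ≫ pullback.snd g s
    have hr : r ≫ s = t ≫ g := by simp [r, t, P, pullback.condition]
    have hZ' := (IsPullback.of_hasPullback snd r).paste_horiz hZ
    rw [hr] at hZ'
    have : IsIntegral (pullback snd r) :=
      GeometricallyIntegral.geometrically_isIntegral (f := f') (K := P.residueField y) t _ _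
        (hZ'.of_right' h)
    have : Surjective r := ⟨Function.surjective_to_subsingleton _⟩
    exact IsIntegral.of_flat_of_surjective (pullback.fst snd r)

end Descent

lemma GeometricallyIntegral.comp (f : X ⟶ Y) (g : Y ⟶ S) [GeometricallyIntegral f] [Flat f]
    [UniversallyOpen f] [GeometricallyIntegral g] [LocallyOfFiniteType g] :
    GeometricallyIntegral (f ≫ g) where
  geometrically_isIntegral K _ s Z fst snd hZ := by
    have : IsIntegral (pullback g s) := pullback_of_geometrically geometrically_isIntegral K s
    have : IsLocallyNoetherian (pullback g s) :=
      LocallyOfFiniteType.isLocallyNoetherian (pullback.snd g s)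
    have h := (IsPullback.of_hasPullback f (pullback.fst g s)).paste_vert
      (IsPullback.of_hasPullback g s)
    exact .of_flat_of_surjective (h.isoIsPullback _ _ hZ).hom

end AlgebraicGeometry

/-! ### Geometric irreducibility of connected group schemes. -/

/-- A connected space in which every point has an irreducible open neighborhood is irreducible. -/
lemma irreducibleSpace_of_connectedSpace_of_forall_exists_isOpen {X : Type*} [TopologicalSpace X]
    [ConnectedSpace X] (H : ∀ x : X, ∃ U : Set X, IsOpen U ∧ x ∈ U ∧ IsPreirreducible U) :
    IrreducibleSpace X := by
  obtain ⟨x⟩ : Nonempty X := inferInstance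
  obtain ⟨U, hU, hxU, hU'⟩ := H x
  have hcl : IsClopen (closure U) := by
    refine ⟨isClosed_closure, isOpen_iff_forall_mem_open.mpr fun y hy ↦ ?_⟩
    obtain ⟨W, hW, hyW, hW'⟩ := H y
    refine ⟨W, ?_, hW, hyW⟩
    have hne : (W ∩ U).Nonempty := mem_closure_iff.mp hy W hW hyW
    intro w hw
    refine mem_closure_iff.mpr fun O hO hwO ↦ ?_
    obtain ⟨v, -, hv⟩ := hW' O U hO hU ⟨w, hw, hwO⟩ hne
    exact ⟨v, hv⟩
  have huniv : closure U = Set.univ := hcl.eq_univ ⟨x, subset_closure hxU⟩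
  rw [irreducibleSpace_def, Set.top_eq_univ, ← huniv]
  exact isIrreducible_iff_closure.mpr ⟨⟨x, hxU⟩, hU'⟩

namespace AlgebraicGeometry

variable {X Z : Scheme.{u}} {K L : Type u} [Field K] [Field L]

/-- The fiber over a rational point of the base change of a scheme along a field extension is a
single point. -/
lemma subsingleton_preimage_of_isPullback_of_section {f : X ⟶ Spec (.of K)}
    {h : Spec (.of L) ⟶ Spec (.of K)} {fst : Z ⟶ X} {snd : Z ⟶ Spec (.of L)}
    (hZ : IsPullback fst snd f h) (σ : Spec (.of K) ⟶ X) (hσ : σ ≫ f = 𝟙 _)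
    (s : Spec (.of K)) : (fst ⁻¹' {σ s}).Subsingleton := by
  let τ : Spec (.of L) ⟶ Z := hZ.lift (h ≫ σ) (𝟙 _) (by simp [hσ])
  have hτ : IsPullback τ h fst σ := by
    refine .of_right ?_ (by simp [τ]) hZ.flip
    simpa [τ, hσ] using IsPullback.of_id_fst (f := h)
  have key (z : Z) (hz : fst z = σ s) : z = τ (IsLocalRing.closedPoint L) := by
    obtain ⟨y, hy, -⟩ := Scheme.exists_preimage_of_isPullback hτ z s hz
    rw [← hy]
    exact congr(τ $(Subsingleton.elim _ _))
  intro z hz z' hz'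
  rw [key z hz, key z' hz']

/-- A connected scheme over a field `K` with a rational point stays connected over
algebraic extensions of `K`. -/
lemma connectedSpace_of_isPullback_of_isIntegralHom_of_section [ConnectedSpace X]
    {f : X ⟶ Spec (.of K)} {h : Spec (.of L) ⟶ Spec (.of K)} [IsIntegralHom h]
    {fst : Z ⟶ X} {snd : Z ⟶ Spec (.of L)} (hZ : IsPullback fst snd f h)
    (σ : Spec (.of K) ⟶ X) (hσ : σ ≫ f = 𝟙 _) : ConnectedSpace Z := by
  have : UniversallyOpen fst := MorphismProperty.of_isPullback hZ.flip inferInstance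
  have : IsIntegralHom fst := MorphismProperty.of_isPullback hZ.flip inferInstance
  have : Surjective h := ⟨Function.surjective_to_subsingleton _⟩
  have : Surjective fst := MorphismProperty.of_isPullback hZ.flip inferInstance
  have : Nonempty Z := fst.surjective.nonempty
  have : PreconnectedSpace Z := by
    rw [preconnectedSpace_iff_clopen]
    intro s hs
    -- `fst` is open and closed, so `s` and its complement, if both nonempty, would both meet the
    -- one-point fiber over the rational point.
    have H (t : Set Z) (ht : IsClopen t) : t = ∅ ∨ fst '' t = Set.univ := by
      rw [or_iff_not_imp_left, ← ne_eq, ← Set.nonempty_iff_ne_empty]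
      exact fun hne ↦ IsClopen.eq_univ ⟨fst.isClosedMap _ ht.1, fst.isOpenMap _ ht.2⟩ (hne.image _)
    obtain hs' | hs' := H s hs
    · exact .inl hs'
    obtain ht' | ht' := H sᶜ hs.compl
    · exact .inr (Set.compl_empty_iff.mp ht')
    let x := σ (IsLocalRing.closedPoint K)
    obtain ⟨z, hz, hzx⟩ := hs'.ge (Set.mem_univ x)
    obtain ⟨z', hz', hzx'⟩ := ht'.ge (Set.mem_univ x)
    obtain rfl := subsingleton_preimage_of_isPullback_of_section hZ σ hσ _ hzx hzx'
    exact (hz' hz).elim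
  constructor
  infer_instance

/-- An irreducible scheme locally of finite type over an algebraically closed field stays
irreducible over all field extensions. -/
lemma irreducibleSpace_of_isPullback_of_isAlgClosed [IsAlgClosed K] [IrreducibleSpace X]
    {f : X ⟶ Spec (.of K)} [LocallyOfFiniteType f] {h : Spec (.of L) ⟶ Spec (.of K)}
    {fst : Z ⟶ X} {snd : Z ⟶ Spec (.of L)} (hZ : IsPullback fst snd f h) :
    IrreducibleSpace Z := by
  have : UniversallyOpen fst := MorphismProperty.of_isPullback hZ.flip inferInstance
  have : Surjective h := ⟨Function.surjective_to_subsingleton _⟩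
  have : Surjective fst := MorphismProperty.of_isPullback hZ.flip inferInstance
  have : Nonempty Z := fst.surjective.nonempty
  have : JacobsonSpace X := LocallyOfFiniteType.jacobsonSpace f
  rw [irreducibleSpace_def]
  refine ⟨Set.univ_nonempty, ?_⟩
  rw [Set.top_eq_univ, ← Set.preimage_univ (f := fst)]
  refine (IrreducibleSpace.isIrreducible_univ X).isPreirreducible
    |>.preimage_of_dense_isPreirreducible_fiber _ fst.isOpenMap ?_
  -- Closed points are dense and, `K` being algebraically closed, rational, so their fibers are
  -- single points.
  rw [Set.univ_inter, ← closure_closedPoints]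
  refine closure_mono fun x hx ↦ ?_
  have H := subsingleton_preimage_of_isPullback_of_section hZ (pointOfClosedPoint f x hx)
    (pointOfClosedPoint_comp f x hx) (IsLocalRing.closedPoint K)
  have hx' := pointOfClosedPoint_apply f x hx (IsLocalRing.closedPoint K)
  exact (hx' ▸ H).isPreirreducible

/-- A connected group scheme of finite type over an algebraically closed field is irreducible. -/
lemma irreducibleSpace_of_grpObj_of_isAlgClosed [IsAlgClosed K] [ConnectedSpace X]
    (f : X ⟶ Spec (.of K)) [LocallyOfFiniteType f] [QuasiCompact f] [GrpObj (Over.mk f)] :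
    IrreducibleSpace X := by
  have := LocallyOfFiniteType.jacobsonSpace f
  have : CompactSpace X := (quasiCompact_iff_compactSpace f).mp ‹_›
  have : IsNoetherian X := { __ := LocallyOfFiniteType.isLocallyNoetherian f }
  let V : Set X := ⋃₀ {U | IsOpen U ∧ IsPreirreducible U}
  have hV : IsOpen V := isOpen_sUnion fun U hU ↦ hU.1
  suffices h : V = Set.univ by
    refine irreducibleSpace_of_connectedSpace_of_forall_exists_isOpen fun x ↦ ?_
    obtain ⟨U, ⟨hU, hU'⟩, hx⟩ := h.ge (Set.mem_univ x)
    exact ⟨U, hU, hx, hU'⟩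
  have hne : V.Nonempty := by
    obtain ⟨x⟩ : Nonempty X := inferInstance
    -- The complement of all other components is open and lies in a single component.
    let U : Set X := (⋃₀ (irreducibleComponents X \ {irreducibleComponent x}))ᶜ
    have hU : IsOpen U := by
      rw [isOpen_compl_iff, Set.sUnion_eq_biUnion]
      exact TopologicalSpace.NoetherianSpace.finite_irreducibleComponents.sdiff.isClosed_biUnion
        fun W hW ↦ isClosed_of_mem_irreducibleComponents W hW.1
    have hcl : closure U = irreducibleComponent x :=
      closure_sUnion_irreducibleComponents_sdiff_singleton
        TopologicalSpace.NoetherianSpace.finite_irreducibleComponents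
        _ (irreducibleComponent_mem_irreducibleComponents x)
    have hU' : IsIrreducible U :=
      isIrreducible_iff_closure.mp (hcl ▸ isIrreducible_irreducibleComponent)
    obtain ⟨u, hu⟩ := hU'.nonempty
    exact ⟨u, U, ⟨hU, hU'.isPreirreducible⟩, hu⟩
  rw [← Set.compl_empty_iff, ← Set.not_nonempty_iff_eq_empty]
  intro H
  -- Homogeneity: a translation carries the rational point `x` outside `V` to the rational point `y`
  -- in `V`, and pulls an irreducible neighborhood back to `x`.
  obtain ⟨x, hx, hxc⟩ := nonempty_inter_closedPoints H hV.isClosed_compl.isLocallyClosed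
  obtain ⟨y, hy, hyc⟩ := nonempty_inter_closedPoints hne hV.isLocallyClosed
  let x' : 𝟙_ _ ⟶ Over.mk f := Over.homMk _ ((pointEquivClosedPoint f).symm ⟨x, hxc⟩).2
  let y' : 𝟙_ _ ⟶ Over.mk f := Over.homMk _ ((pointEquivClosedPoint f).symm ⟨y, hyc⟩).2
  let α := (GrpObj.mulRight (A := Over.mk f) x').symm ≪≫
    (GrpObj.mulRight (A := Over.mk f) y')
  have hα : x' ≫ α.hom = y' := by
    dsimp only [Iso.trans_hom, Iso.symm_hom, α]
    rw [← Category.assoc, ← Iso.eq_comp_inv]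
    simp [comp_lift_assoc]
  have hα' : α.hom.left x = y := by
    let a : X ⟶ X := α.hom.left
    have h : pointOfClosedPoint f x hxc ≫ a = pointOfClosedPoint f y hyc := congr(($hα).left)
    have h' := congr($h (IsLocalRing.closedPoint K : Spec (.of K)))
    exact (congrArg a (pointOfClosedPoint_apply f x hxc _)).symm.trans
      (h'.trans (pointOfClosedPoint_apply f y hyc _))
  obtain ⟨U, ⟨hU, hU'⟩, hyU⟩ := hy
  refine hx ⟨α.hom.left ⁻¹' U, ⟨hU.preimage α.hom.left.continuous, ?_⟩, ?_⟩
  · have : IsIso α.hom.left := inferInstanceAs (IsIso ((Over.forget _).map α.hom))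
    exact hU'.preimage (Scheme.Hom.isOpenEmbedding (X := X) (Y := X) α.hom.left)
  · rwa [Set.mem_preimage, hα']

/-- A connected group scheme of finite type over a field is geometrically irreducible. -/
lemma GeometricallyIrreducible.of_grpObj [ConnectedSpace X]
    (f : X ⟶ Spec (.of K)) [LocallyOfFiniteType f] [QuasiCompact f] [GrpObj (Over.mk f)] :
    GeometricallyIrreducible f where
  geometrically_irreducibleSpace := by
    rw [geometrically_iff_of_commRing]
    intro L _ _ Z fst snd hZ
    -- Connectedness passes to `K'` through the unit section and becomes irreducibility there; this
    -- passes up to `Ω` and then down to `L`.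
    let K' := AlgebraicClosure K
    let Ω := AlgebraicClosure L
    let a : Spec (.of K') ⟶ Spec (.of K) := Spec.map (CommRingCat.ofHom (algebraMap K K'))
    let b : Spec (.of Ω) ⟶ Spec (.of L) := Spec.map (CommRingCat.ofHom (algebraMap L Ω))
    let φ : K' →ₐ[K] Ω := IsAlgClosed.lift
    let c : Spec (.of Ω) ⟶ Spec (.of K') := Spec.map (CommRingCat.ofHom φ.toRingHom)
    have hc : c ≫ a = b ≫ Spec.map (CommRingCat.ofHom (algebraMap K L)) := by
      simp only [a, b, c, ← Spec.map_comp, ← CommRingCat.ofHom_comp]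
      congr 2
      ext x
      simpa using (IsScalarTower.algebraMap_apply K L Ω x)
    have : IsIntegralHom a := by
      rw [IsIntegralHom.SpecMap_iff]
      exact algebraMap_isIntegral_iff.mpr inferInstance
    have h₁ := IsPullback.of_hasPullback f a
    have : ConnectedSpace ↥(pullback f a) :=
      connectedSpace_of_isPullback_of_isIntegralHom_of_section h₁ η[Over.mk f].left
        (Over.w η[Over.mk f])
    let : GrpObj (Over.mk (pullback.snd f a)) := Over.grpObjMkPullbackSnd
    have : IrreducibleSpace ↥(pullback f a) :=
      irreducibleSpace_of_grpObj_of_isAlgClosed (pullback.snd f a)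
    have h₂ := (IsPullback.of_hasPullback snd b).paste_horiz hZ
    rw [← hc] at h₂
    have : IrreducibleSpace ↥(pullback snd b) :=
      irreducibleSpace_of_isPullback_of_isAlgClosed (h₂.of_right' h₁)
    have : Surjective b := ⟨Function.surjective_to_subsingleton _⟩
    exact (pullback.fst snd b).surjective.irreducibleSpace (pullback.fst snd b).continuous

end AlgebraicGeometry

/-! ### Smoothness of retracts. -/

/-- A retract of a formally smooth algebra is formally smooth. -/
lemma Algebra.FormallySmooth.of_retract {R A B : Type u} [CommRing R] [CommRing A] [CommRing B]
    [Algebra R A] [Algebra R B] (a : A →ₐ[R] B) (b : B →ₐ[R] A) (hab : b.comp a = .id R A)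
    [Algebra.FormallySmooth R B] : Algebra.FormallySmooth R A := by
  refine .of_comp_surjective fun C _ _ I hI g ↦ ?_
  obtain ⟨l, hl⟩ := Algebra.FormallySmooth.comp_surjective R B I hI (g.comp b)
  refine ⟨l.comp a, ?_⟩
  rw [← AlgHom.comp_assoc, hl, AlgHom.comp_assoc, hab, AlgHom.comp_id]

namespace AlgebraicGeometry

/-- Let `r : Y ⟶ X` be an affine morphism with a section. If `Y` is smooth over an affine
scheme, then so is `X`. -/
lemma Smooth.of_retract {X Y : Scheme.{u}} {R : CommRingCat.{u}} (f : X ⟶ Spec R)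
    [LocallyOfFinitePresentation f] (i : X ⟶ Y) (r : Y ⟶ X) (hir : i ≫ r = 𝟙 X) [IsAffineHom r]
    [Smooth (r ≫ f)] : Smooth f := by
  wlog hX : ∃ A, X = Spec A generalizing X Y
  · have hloc : IsZariskiLocalAtSource @Smooth.{u} := HasRingHomProperty.instIsZariskiLocalAtSource
    rw [IsZariskiLocalAtSource.iff_of_openCover (P := @Smooth.{u}) X.affineCover]
    intro j
    let c := X.affineCover.f j
    have hc : Smooth (pullback.snd r c ≫ c ≫ f) := by
      rw [← pullback.condition_assoc]
      exact smooth_comp (pullback.fst r c) (r ≫ f)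
    exact this (c ≫ f) (pullback.lift (c ≫ i) (𝟙 _) (by simp [hir])) (pullback.snd r c)
      (pullback.lift_snd _ _ _) ⟨_, rfl⟩
  obtain ⟨A, rfl⟩ := hX
  have : IsAffine Y := isAffine_of_isAffineHom r
  wlog hY : ∃ B, Y = Spec B generalizing Y
  · have hs : Smooth ((Y.isoSpec.inv ≫ r) ≫ f) := by
      rw [Category.assoc]
      infer_instance
    exact this (i ≫ Y.isoSpec.hom) (Y.isoSpec.inv ≫ r) (by simpa) inferInstance ⟨_, rfl⟩
  obtain ⟨B, rfl⟩ := hY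
  obtain ⟨φ, rfl⟩ := Spec.map_surjective f
  obtain ⟨a, rfl⟩ := Spec.map_surjective r
  obtain ⟨b, rfl⟩ := Spec.map_surjective i
  rw [← Spec.map_comp, ← Spec.map_id, Spec.map_injective.eq_iff] at hir
  have hφ := (HasRingHomProperty.Spec_iff (P := @LocallyOfFinitePresentation)).mp
    ‹LocallyOfFinitePresentation (Spec.map φ)›
  have hs : Smooth (Spec.map (φ ≫ a)) := by rwa [Spec.map_comp]
  rw [HasRingHomProperty.Spec_iff (P := @Smooth)] at hs ⊢
  algebraize [φ.hom, (φ ≫ a).hom]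
  have hb : φ ≫ a ≫ b = φ := by simp [hir]
  have := Algebra.FormallySmooth.of_retract (R := R)
    { a.hom with commutes' := fun _ ↦ rfl }
    { b.hom with commutes' := fun x ↦ congr(($hb).hom x) }
    (AlgHom.ext fun x ↦ congr(($hir).hom x))
  exact (RingHom.smooth_def).mpr ⟨this, ‹_›⟩

end AlgebraicGeometry

/-! ### Equivariant morphisms to an orbit. -/

namespace CategoryTheory.ModObj

variable {C : Type*} [Category C] [CartesianMonoidalCategory C] {G : C} {A B F T : C}

lemma lift_mul_smul [MonObj G] [ModObj G A] (g h : T ⟶ G) (a : T ⟶ A) :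
    lift (lift g h ≫ μ) a ≫ γ[G, A] = lift g (lift h a ≫ γ[G, A]) ≫ γ[G, A] := by
  calc
    _ = lift (lift g h) a ≫ μ ▷ A ≫ γ[G, A] := by rw [lift_whiskerRight_assoc]
    _ = _ := by rw [mul_smul_self]; simp

lemma lift_one_smul [MonObj G] [ModObj G A] (a : T ⟶ A) :
    lift (toUnit T ≫ η) a ≫ γ[G, A] = a := by
  calc
    _ = lift (toUnit T) a ≫ η ▷ A ≫ γ[G, A] := by rw [lift_whiskerRight_assoc]
    _ = _ := by rw [one_smul_self]; simp

lemma lift_smul_comp [MonObj G] [ModObj G A] [ModObj G B] (f : A ⟶ B) [IsModHom G f]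
    (g : T ⟶ G) (a : T ⟶ A) :
    (lift g a ≫ γ[G, A]) ≫ f = lift g (a ≫ f) ≫ γ[G, B] := by
  have h : γ[G, A] ≫ f = G ◁ f ≫ γ[G, B] := IsModHom.smul_hom
  simp [h]

/-- Let `f : A ⟶ B` be a `G`-equivariant morphism and let `π : G ⟶ B` be an orbit map. The base
change of `f` along `π` is the projection `G ⊗ F ⟶ G`, where `F` is the fiber of `f` over the
base point of `B`. -/
lemma isPullback_smul_of_isPullback [GrpObj G] [ModObj G A] [ModObj G B] (f : A ⟶ B) [IsModHom G f]
    (π : G ⟶ B) (hπ : μ[G] ≫ π = G ◁ π ≫ γ[G, B]) {j : F ⟶ A}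
    (h : IsPullback j (toUnit F) f (η[G] ≫ π)) :
    IsPullback (G ◁ j ≫ γ[G, A]) (fst G F) f π := by
  have hmul {T : C} (g : T ⟶ G) : lift g (toUnit T ≫ η[G] ≫ π) ≫ γ[G, B] = g ≫ π := by
    have := lift g (toUnit T ≫ η) ≫= hπ
    simpa using this.symm
  have hinv {T D : C} [ModObj G D] (g : T ⟶ G) (a : T ⟶ D) :
      lift (g ≫ ι) (lift g a ≫ γ[G, D]) ≫ γ[G, D] = a := by
    rw [← lift_mul_smul, GrpObj.lift_comp_inv_left, lift_one_smul]
  have hinv' {T D : C} [ModObj G D] (g : T ⟶ G) (a : T ⟶ D) :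
      lift g (lift (g ≫ ι) a ≫ γ[G, D]) ≫ γ[G, D] = a := by
    rw [← lift_mul_smul, GrpObj.lift_comp_inv_right, lift_one_smul]
  have hG {T : C} (m : T ⟶ G ⊗ F) :
      m ≫ G ◁ j ≫ γ[G, A] = lift (m ≫ fst _ _) ((m ≫ snd _ _) ≫ j) ≫ γ[G, A] := by
    rw [← Category.assoc]
    congr 1
    ext <;> simp
  -- The inverse sends (g, a) with f(a) = π(g) = g·π(1) to (g, g⁻¹·a).
  refine ⟨⟨?_⟩, ⟨PullbackCone.IsLimit.mk _
    (fun s ↦ lift s.snd (h.lift (lift (s.snd ≫ ι) s.fst ≫ γ[G, A]) (toUnit _) ?_)) ?_ ?_ ?_⟩⟩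
  · rw [← Category.id_comp (G ◁ j ≫ _), hG, lift_smul_comp, Category.assoc, h.w,
      ← hmul (fst G F)]
    simp
  · rw [lift_smul_comp, s.condition, ← hmul s.snd, hinv]
  · intro s
    rw [hG]
    simp [hinv']
  · intro s
    simp
  · intro s m h₁ h₂
    rw [hG, h₂] at h₁
    ext
    · simpa using h₂
    · apply h.hom_ext
      · simp [← h₁, hinv]
      · exact toUnit_unique _ _

end CategoryTheory.ModObj

/-! ### The quotient map `π` and the main theorem. -/

namespace GVar

variable {k : Type u} [Field k]

lemma IsConnectedLinearAlgebraicGroup.geometricallyIntegral {G : Over (Spec (.of k))} [GrpObj G]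
    (hG : IsConnectedLinearAlgebraicGroup G) : GeometricallyIntegral G.hom := by
  have := hG.smooth
  have := hG.connected
  have := hG.locallyOfFiniteType
  have := hG.quasiCompact
  have : GrpObj (Over.mk G.hom) := ‹GrpObj G›
  have : GeometricallyIrreducible G.hom := .of_grpObj G.hom
  exact .of_geometricallyReduced_of_geometricallyIrreducible _

section HomogeneousQuotient

variable {G G₁ B : Over (Spec (.of k))} [GrpObj G] [GrpObj G₁] [ModObj G B] {i : G₁ ⟶ G}
  {π : G ⟶ B}

lemma IsHomogeneousQuotient.isPullback_left (hπ : IsHomogeneousQuotient i π) :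
    IsPullback (G ◁ i ≫ μ[G]).left (fst G G₁).left π.left π.left :=
  (hπ.isPullback.map (Over.forget _)).flip

lemma IsHomogeneousQuotient.geometricallyIntegral (hπ : IsHomogeneousQuotient i π)
    (hG₁ : IsConnectedLinearAlgebraicGroup G₁) : GeometricallyIntegral π.left := by
  have := hG₁.geometricallyIntegral
  have := hπ.surjective
  have : GeometricallyIntegral (fst G G₁).left :=
    inferInstanceAs (GeometricallyIntegral (pullback.fst G.hom G₁.hom))
  exact .of_isPullback_of_surjective hπ.isPullback_left

lemma IsHomogeneousQuotient.smooth (hπ : IsHomogeneousQuotient i π) [QuasiCompact π.left]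
    (hG₁ : IsConnectedLinearAlgebraicGroup G₁) : Smooth π.left := by
  have := hG₁.smooth
  have : Smooth (fst G G₁).left := inferInstanceAs (Smooth (pullback.fst G.hom G₁.hom))
  exact MorphismProperty.of_isPullback_of_descendsAlong
    (Q := @Surjective ⊓ @Flat ⊓ @QuasiCompact) hπ.isPullback_left.flip
    ⟨⟨hπ.surjective, hπ.flat⟩, ‹_›⟩ this

end HomogeneousQuotient

end GVar

theorem proposition2p2 {k : Type u} [Field k] [CharZero k]
    -- connected linear algebraic groups `G₁ ⊆ G` over `k`
    (G G₁ : Over (Spec (.of k))) [GrpObj G] [GrpObj G₁]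
    (hG : GVar.IsConnectedLinearAlgebraicGroup G)
    (hG₁ : GVar.IsConnectedLinearAlgebraicGroup G₁)
    (i : G₁ ⟶ G) (hi : GVar.IsClosedSubgroup i)
    -- geometrically integral `G`-varieties `A` and `B`
    (A B : Over (Spec (.of k))) [ModObj G A] [ModObj G B]
    (hA : GVar.IsGeomIntegralVariety A) (hB : GVar.IsGeomIntegralVariety B)
    -- `B = G / G₁` is affine and smooth
    (hBaff : IsAffine B.left) (hBsm : Smooth B.hom)
    (π : G ⟶ B) (hπ : GVar.IsHomogeneousQuotient i π)
    -- a `G`-morphism `A ⟶ B`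
    (f : A ⟶ B) [IsModHom G f] :
    (∀ b : B.left, Nonempty (f.left.fiber b) ∧
      GeometricallyIntegral (f.left.fiberToSpecResidueField b)) ∧
    (Smooth A.hom → Smooth f.left) := by
 
  have := hG.isAffine
  have := hG.smooth
  have := hA.locallyOfFiniteType
  have := hA.geometricallyIntegral
  have := hπ.surjective
  have hqc : QuasiCompact π.left := inferInstance
  have := hπ.smooth hG₁
  have := hπ.geometricallyIntegral hG₁
  let j : pullback f (η[G] ≫ π) ⟶ A := pullback.fst _ _
  let F := pullback f (η[G] ≫ π)
  have hj : IsPullback j (toUnit F) f (η[G] ≫ π) := by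
    have := IsPullback.of_hasPullback f (η[G] ≫ π)
    rwa [toUnit_unique (pullback.snd f (η[G] ≫ π)) (toUnit F)] at this
  have hsq : IsPullback (G ◁ j ≫ γ[G, A]).left (fst G F).left f.left π.left :=
    (CategoryTheory.ModObj.isPullback_smul_of_isPullback f π hπ.equivariant hj).map (Over.forget _)
  have hact : (snd G F).left ≫ F.hom = (G ◁ j ≫ γ[G, A]).left ≫ A.hom := by
    rw [Over.w, Over.w]
  have hF : GeometricallyIntegral F.hom := by
    have := hG.connected
    have : Surjective G.hom := ⟨Function.surjective_to_subsingleton (β := Spec (.of k)) _⟩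
    have : Flat (snd G F).left := inferInstanceAs (Flat (pullback.snd G.hom F.hom))
    have : Surjective (snd G F).left := inferInstanceAs (Surjective (pullback.snd G.hom F.hom))
    have : GeometricallyIntegral (G ◁ j ≫ γ[G, A]).left :=
      MorphismProperty.of_isPullback hsq.flip ‹GeometricallyIntegral π.left›
    have : Smooth (G ◁ j ≫ γ[G, A]).left :=
      MorphismProperty.of_isPullback hsq.flip ‹Smooth π.left›
    have : GeometricallyIntegral ((snd G F).left ≫ F.hom) := by
      rw [hact]
      exact .comp _ _
    exact .of_comp_of_flat_of_surjective (snd G F).left F.hom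
  have hf : GeometricallyIntegral f.left := by
    have : GeometricallyIntegral (fst G F).left :=
      inferInstanceAs (GeometricallyIntegral (pullback.fst G.hom F.hom))
    exact .of_isPullback_of_surjective hsq
  refine ⟨fun b ↦ ⟨inferInstance, inferInstance⟩, fun hAsm ↦ ?_⟩
  have hFsm : Smooth F.hom := by
    have : IsAffineHom G.hom := isAffineHom_of_isAffine (Y := Spec (.of k)) G.hom
    have : IsAffineHom (snd G F).left :=
      MorphismProperty.of_isPullback (IsPullback.of_hasPullback G.hom F.hom) this
    have : Smooth (G ◁ j ≫ γ[G, A]).left :=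
      MorphismProperty.of_isPullback hsq.flip ‹Smooth π.left›
    have : Smooth ((snd G F).left ≫ F.hom) := by
      rw [hact]
      infer_instance
    have : LocallyOfFiniteType f.left := by
      have : LocallyOfFiniteType (f.left ≫ B.hom) := by rwa [Over.w]
      exact locallyOfFiniteType_of_comp f.left B.hom
    have : LocallyOfFiniteType F.hom :=
      MorphismProperty.of_isPullback (hj.map (Over.forget _)) ‹LocallyOfFiniteType f.left›
    have : LocallyOfFinitePresentation F.hom :=
      LocallyOfFinitePresentation.iff_locallyOfFiniteType.mpr this
    -- x ↦ (1, x) is a section of the affine projection G × F → F.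
    refine .of_retract F.hom (lift (toUnit F ≫ η[G]) (𝟙 F)).left (snd G F).left ?_
    rw [← Over.comp_left, lift_snd, Over.id_left]
  have : Smooth (fst G F).left := inferInstanceAs (Smooth (pullback.fst G.hom F.hom))
  exact MorphismProperty.of_isPullback_of_descendsAlong
    (Q := @Surjective ⊓ @Flat ⊓ @QuasiCompact) hsq.flip ⟨⟨hπ.surjective, hπ.flat⟩, hqc⟩ this
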